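/- Let $\alpha\ge 0$, $\gamma\in\mathbb{R}$ and let $\nu$ be a measure on $\mathbb{R}$ with $\nu(\{0\})=0$ and $\int_{\mathbb R}(y^2\wedge 1)\,\nu(dy)<\infty$, where $\alpha,\gamma,\nu$ are not all zero. Put $$\eta(u)=-\tfrac12\alpha^2u^2+iu\gamma+\int_{\mathbb{R}\setminus\{0\}}\bigl(e^{iuy}-1-iuy\,\mathbf 1_{\{|y|\le 1\}}\bigr)\,\nu(dy),\qquad u\in\mathbb{R}.$$ Let $\mu_0(dx)=h_0(x)\,dx$ and $\mu_1(dx)=h_1(x)\,dx$ be probability measures on $\mathbb{R}$ with measurable densities $h_0,h_1\ge 0$, and write $\widehat{h}(u)=\int_{\mathbb{R}}e^{iux}h(x)\,dx$. On a complete probability space $(\Omega,\mathcal F,\mathbb{P}^{\mu_0})$ let $L=\tilde L+X_0$, where $X_0\sim\mu_0$ is independent of $\tilde L$ and $\tilde L$ is a real-valued Lévy process (almost surely right-continuous with left limits, almost surely issued from $0$, stochastically continuous, with stationary and independent increments) such that $\mathbb{E}^{\mu_0}[e^{iu\tilde L_t}]=e^{t\eta(u)}$ for all $u\in\mathbb{R}$,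 $t\ge 0$. Let $(\mathcal F_t)_{t\ge 0}$ be the $\mathbb{P}^{\mu_0}$-augmented natural filtration of $L$, and let $\tau$ be an $(\mathcal F_t)$-stopping time with $L_\tau\sim\mu_1$ and $\mathbb{E}^{\mu_0}[\tau]<\infty$. Then for every $u\in\mathbb{R}$ the random variable $\int_0^\tau e^{iuL_s}\,ds$ is almost surely well defined and integrable, and $$\eta(u)\,\mathbb{E}^{\mu_0}\Bigl[\int_0^{\tau}e^{iuL_s}\,ds\Bigr]=\widehat{h_1}(u)-\widehat{h_0}(u).$$ Moreover $\eta(u)\neq 0$ for Lebesgue-almost every $u$, and for every $R>0$ $$\int_{|u|\le R}\left|\frac{\widehat{h_1}(u)-\widehat{h_0}(u)}{\eta(u)}\right|\,du<\infty,$$ that is, $(\widehat{h_1}-\widehat{h_0})/\eta$ is integrable on every compact set. -/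

import Mathlib

open MeasureTheory ProbabilityTheory Filter Topology
open scoped NNReal ENNReal

namespace SkorokhodLevy

/-- A Lévy triplet `(α², γ, ν)`: `α ≥ 0`, `γ ∈ ℝ`, and a measure `ν` on `ℝ` with `ν {0} = 0` and
`∫ (y² ∧ 1) ν(dy) < ∞`. -/
structure LevyTriplet where
  α : ℝ
  γ : ℝ
  ν : Measure ℝ
  α_nonneg : 0 ≤ α
  ν_zero : ν {0} = 0
  ν_lintegral : ∫⁻ y, ENNReal.ofReal (min (y ^ 2) 1) ∂ν < ∞

open Classical in
/-- The characteristic exponent given by the Lévy-Khintchine formula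
`η(u) = -½ α² u² + i u γ + ∫_{ℝ∖{0}} (e^{iuy} - 1 - i u y 1_{|y| ≤ 1}) ν(dy)`. -/
noncomputable def LevyTriplet.exponent (T : LevyTriplet) (u : ℝ) : ℂ :=
  -(1 / 2) * (T.α : ℂ) ^ 2 * (u : ℂ) ^ 2 + Complex.I * u * T.γ +
    ∫ y in ({0}ᶜ : Set ℝ), (Complex.exp (Complex.I * u * y) - 1 -
      (if |y| ≤ 1 then Complex.I * u * y else 0)) ∂T.ν

/-- The triplet is not that of the constant Lévy process. -/
def LevyTriplet.Nontrivial (T : LevyTriplet) : Prop :=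
  ¬ (T.α = 0 ∧ T.γ = 0 ∧ T.ν = 0)

section

variable {Ω : Type*} {mΩ : MeasurableSpace Ω}

/-- A real-valued Lévy process `(X_t)_{t ≥ 0}` (issued from `0`) on `(Ω, P)`. -/
structure IsLevyProcess (X : ℝ≥0 → Ω → ℝ) (P : Measure Ω) : Prop where
  measurable : ∀ t, Measurable (X t)
  rcll : ∀ᵐ ω ∂P, ∀ t : ℝ≥0, ContinuousWithinAt (fun s => X s ω) (Set.Ici t) t ∧
    ∃ l : ℝ, Tendsto (fun s => X s ω) (𝓝[<] t) (𝓝 l)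
  start_zero : ∀ᵐ ω ∂P, X 0 ω = 0
  stochCont : ∀ t : ℝ≥0, TendstoInMeasure P X (𝓝 t) (X t)
  stationary : ∀ s t : ℝ≥0,
    IdentDistrib (fun ω => X (s + t) ω - X s ω) (fun ω => X t ω - X 0 ω) P P
  indep : HasIndepIncrements X P

/-- `T` is the Lévy triplet of `X`: `E[e^{iuX_t}] = e^{t η(u)}` for all `u` and `t ≥ 0`. -/
def HasLevyTriplet (X : ℝ≥0 → Ω → ℝ) (T : LevyTriplet) (P : Measure Ω) : Prop :=
  ∀ (t : ℝ≥0) (u : ℝ),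
    ∫ ω, Complex.exp (Complex.I * u * X t ω) ∂P = Complex.exp ((t : ℝ) * T.exponent u)

/-- `L` is a Lévy process with triplet `T` and initial distribution `μ₀`: `L = X + X₀`, where `X` is
a Lévy process with triplet `T` and `X₀ ∼ μ₀` is independent of the process `X`. -/
def IsLevyProcessFrom (L : ℝ≥0 → Ω → ℝ) (T : LevyTriplet) (μ₀ : Measure ℝ) (P : Measure Ω) :
    Prop :=
  ∃ (X : ℝ≥0 → Ω → ℝ) (X₀ : Ω → ℝ),
    IsLevyProcess X P ∧ HasLevyTriplet X T P ∧
    Measurable X₀ ∧ HasLaw X₀ μ₀ P ∧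
    IndepFun X₀ (fun ω (t : ℝ≥0) => X t ω) P ∧
    ∀ t ω, L t ω = X t ω + X₀ ω

theorem IsLevyProcessFrom.stronglyMeasurable {L : ℝ≥0 → Ω → ℝ} {T : LevyTriplet} {μ₀ : Measure ℝ}
    {P : Measure Ω} (h : IsLevyProcessFrom L T μ₀ P) (t : ℝ≥0) : StronglyMeasurable (L t) := by
  obtain ⟨X, X₀, hX, -, hX₀, -, -, hL⟩ := h
  have : L t = fun ω => X t ω + X₀ ω := funext (hL t)
  rw [this]
  exact ((hX.measurable t).add hX₀).stronglyMeasurable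

/-- The `P`-augmented natural filtration of a process `L` on a complete space `(Ω, P)`: `𝓕_t` is
generated by `(L_s)_{s ≤ t}` and the `P`-null sets, i.e. it consists of the sets that are
`P`-a.s. equal to a set in `σ(L_s, s ≤ t)`. -/
noncomputable def augmentedFiltration (P : Measure Ω) [P.IsComplete] (L : ℝ≥0 → Ω → ℝ)
    (hL : ∀ t, StronglyMeasurable (L t)) : Filtration ℝ≥0 mΩ where
  seq t := eventuallyMeasurableSpace (Filtration.natural L hL t) (ae P)
  mono' := by
    rintro s t hst A ⟨B, hB, hAB⟩
    exact ⟨B, (Filtration.natural L hL).mono hst B hB, hAB⟩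
  le' := by
    rintro t A ⟨B, hB, hAB⟩
    have h : NullMeasurableSet A P :=
      ⟨B, (Filtration.natural L hL).le t B hB, hAB⟩
    exact h.measurable_of_complete

/-- `τ` is a finite mean solution of the Skorokhod embedding problem for the target law `μ₁`:
an `(𝓕_t)`-stopping time with `L_τ ∼ μ₁` and `E[τ] < ∞`. -/
structure IsFiniteMeanEmbedding (P : Measure Ω) (𝓕 : Filtration ℝ≥0 mΩ) (L : ℝ≥0 → Ω → ℝ)
    (μ₁ : Measure ℝ) (τ : Ω → ℝ≥0∞) : Prop where
  isStoppingTime : IsStoppingTime 𝓕 τ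
  hasLaw : HasLaw (stoppedValue L τ) μ₁ P
  finite_mean : ∫⁻ ω, τ ω ∂P < ∞

end

/-- The measure `h(x) dx`. -/
noncomputable def densityMeasure (h : ℝ → ℝ) : Measure ℝ :=
  volume.withDensity (fun x => ENNReal.ofReal (h x))

/-- The Fourier transform `ĥ(u) = ∫ e^{iux} h(x) dx`. -/
noncomputable def fourierHat (h : ℝ → ℝ) (u : ℝ) : ℂ :=
  ∫ x : ℝ, Complex.exp (Complex.I * u * x) * (h x : ℂ)

/-- The path integral `∫₀^τ e^{iuL_s} ds` (for `τ < ∞`). -/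
noncomputable def expPathIntegral {Ω : Type*} (L : ℝ≥0 → Ω → ℝ) (τ : Ω → ℝ≥0∞) (u : ℝ) (ω : Ω) : ℂ :=
  ∫ s in (0 : ℝ)..(τ ω).toReal, Complex.exp (Complex.I * u * L s.toNNReal ω)

end SkorokhodLevy

/-!
The process `M_t = e^{iuL_t} - η(u) ∫₀^t e^{iuL_s} ds` is a martingale, and optional stopping at `τ`
gives `E e^{iuL_τ} - E e^{iuL_0} = η(u) E ∫₀^τ e^{iuL_s} ds`, whose left side is `ĥ₁(u) - ĥ₀(u)`.
The stopping is carried out on a grid, which avoids joint measurability of the path and continuous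
time martingale theory. The event `{k/n < τ}` lies in the past at time `k/n`, and the next increment
of `L` is independent of that past (`indepFun_past_increment`, `setIntegral_exp_add`), so the mean
of the sum of the increments of `e^{iuL}` over the cells with `k/n < τ`, `k < n²`, is
`n (e^{η(u)/n} - 1)` times the mean of a Riemann sum of `∫₀^τ e^{iuL_s} ds`
(`integral_truncIncrementSum`). Along a right-continuous path the first sum telescopes and tends to
`e^{iuL_τ} - e^{iuL_0}` while the Riemann sum tends to the integral
(`tendsto_truncIncrementSum`, `tendsto_truncRiemannSum`). The sums are bounded by `2` and `τ + 1`,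
so `E τ < ∞` and dominated convergence give the identity
(`exponent_mul_integral_expPathIntegral`).

If `η(u) = 0` for some `u ≠ 0`, the real part shows that the Gaussian part vanishes and that `ν` is
carried by `{y | cos (u y) = 1}`. For fixed `y ≠ 0` this relation holds for countably many `u` only,
so by Tonelli `η` vanishes on a null set unless `ν = 0`, a case in which `η` is an explicit
polynomial (`LevyTriplet.ae_exponent_ne_zero`). Off this null set the quotient `(ĥ₁ - ĥ₀)/η` equals
the mean path integral, which is at most `E τ` in modulus, so the quotient is essentially bounded
and hence integrable on bounded sets.
-/

namespace SkorokhodLevy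

/-! ### Riemann sums of right-continuous functions -/

theorem natCast_div_lt_iff_lt_ceil {t : ℝ≥0} {n : ℕ} (hn : 0 < n) (k : ℕ) :
    (k : ℝ≥0) / n < t ↔ k < ⌈t * n⌉₊ := by
  rw [Nat.lt_ceil, div_lt_iff₀ (by exact_mod_cast hn)]

theorem tendsto_comp_ceil_mul_div {f : ℝ≥0 → ℂ} {t : ℝ≥0}
    (hf : ContinuousWithinAt f (Set.Ici t) t) :
    Tendsto (fun n : ℕ => f ((⌈t * n⌉₊ : ℝ≥0) / n)) atTop (𝓝 (f t)) := by
  refine hf.tendsto.comp (tendsto_nhdsWithin_iff.2 ⟨?_, ?_⟩)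
  · rw [← NNReal.tendsto_coe]
    have h := (tendsto_nat_ceil_mul_div_atTop (R := ℝ) t.2).comp tendsto_natCast_atTop_atTop
    refine h.congr fun n => ?_
    simp only [Function.comp_apply, NNReal.coe_div, NNReal.coe_natCast]
    congr 2
  · filter_upwards [eventually_gt_atTop 0] with n hn
    rw [Set.mem_Ici, le_div_iff₀ (by exact_mod_cast hn)]
    exact Nat.le_ceil _

theorem sum_range_ite_lt {M : Type*} [AddCommMonoid M] (h : ℕ → M) (m N : ℕ) :
    (∑ k ∈ Finset.range m, if k < N then h k else 0) = ∑ k ∈ Finset.range (min N m), h k := by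
  rw [← Finset.sum_filter]
  congr 1
  ext k
  simp [and_comm]

theorem ceil_mul_le_sq {t : ℝ≥0} {n : ℕ} (h : t ≤ n) : ⌈t * n⌉₊ ≤ n ^ 2 := by
  refine Nat.ceil_le.2 ?_
  push_cast
  rw [sq]
  gcongr

/-- The step function equal to `f` at the right end point of each cell of the grid of mesh `1/n`. -/
noncomputable def gridStep (f : ℝ≥0 → ℂ) (n : ℕ) (s : ℝ) : ℂ :=
  f ((⌈s * n⌉₊ : ℝ≥0) / n)

theorem measurable_gridStep (f : ℝ≥0 → ℂ) (n : ℕ) : Measurable (gridStep f n) := by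
  have h : Measurable fun k : ℕ => f ((k : ℝ≥0) / n) := measurable_from_top
  exact h.comp (Nat.measurable_ceil.comp (measurable_id.mul_const _))

theorem intervalIntegrable_of_norm_le_one {g : ℝ → ℂ} {a b : ℝ}
    (hm : AEStronglyMeasurable g (volume.restrict (Set.uIoc a b))) (hb : ∀ s, ‖g s‖ ≤ 1) :
    IntervalIntegrable g volume a b :=
  (intervalIntegrable_const (c := (1 : ℝ))).mono_fun hm (ae_of_all _ fun s => by simpa using hb s)

theorem intervalIntegrable_gridStep {f : ℝ≥0 → ℂ} (hb : ∀ t, ‖f t‖ ≤ 1) (n : ℕ) (a b : ℝ) :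
    IntervalIntegrable (gridStep f n) volume a b :=
  intervalIntegrable_of_norm_le_one (measurable_gridStep f n).aestronglyMeasurable fun _ => hb _

theorem integral_gridStep {f : ℝ≥0 → ℂ} (hb : ∀ t, ‖f t‖ ≤ 1) {n : ℕ} (hn : 0 < n) (N : ℕ) :
    ∫ s in (0 : ℝ)..(N / n), gridStep f n s =
      (1 / n : ℂ) * ∑ k ∈ Finset.range N, f (((k + 1 : ℕ) : ℝ≥0) / n) := by
  have hn' : (0 : ℝ) < n := by exact_mod_cast hn
  have h := intervalIntegral.sum_integral_adjacent_intervals (f := gridStep f n) (μ := volume)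
    (a := fun k : ℕ => (k : ℝ) / n) (n := N) fun k _ => intervalIntegrable_gridStep hb n _ _
  simp only [Nat.cast_zero, zero_div] at h
  rw [← h, Finset.mul_sum]
  refine Finset.sum_congr rfl fun k _ => ?_
  have hle : (k : ℝ) / n ≤ ((k + 1 : ℕ) : ℝ) / n := by gcongr; simp
  have hconst : ∀ s ∈ Set.uIoc ((k : ℝ) / n) (((k + 1 : ℕ) : ℝ) / n),
      gridStep f n s = f (((k + 1 : ℕ) : ℝ≥0) / n) := by
    intro s hs
    rw [Set.uIoc_of_le hle, Set.mem_Ioc, div_lt_iff₀ hn', le_div_iff₀ hn'] at hs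
    have : ⌈s * n⌉₊ = k + 1 := by
      rw [Nat.ceil_eq_iff (by simp)]
      simpa using hs
    simp [gridStep, this]
  rw [intervalIntegral.integral_congr_ae (ae_of_all _ hconst), intervalIntegral.integral_const]
  have : ((k + 1 : ℕ) : ℝ) / n - k / n = 1 / n := by push_cast; ring
  rw [this, Complex.real_smul]
  push_cast
  rfl

theorem tendsto_gridStep {f : ℝ≥0 → ℂ} (hf : ∀ t, ContinuousWithinAt f (Set.Ici t) t) {s : ℝ}
    (hs : 0 ≤ s) : Tendsto (fun n => gridStep f n s) atTop (𝓝 (f s.toNNReal)) := by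
  lift s to ℝ≥0 using hs
  rw [Real.toNNReal_coe]
  refine (tendsto_comp_ceil_mul_div (hf s)).congr fun n => ?_
  have : ⌈(s : ℝ) * n⌉₊ = ⌈s * n⌉₊ := rfl
  rw [gridStep, this]

theorem intervalIntegrable_of_rightContinuous {f : ℝ≥0 → ℂ}
    (hf : ∀ t, ContinuousWithinAt f (Set.Ici t) t) (hb : ∀ t, ‖f t‖ ≤ 1) (t : ℝ≥0) :
    IntervalIntegrable (fun s : ℝ => f s.toNNReal) volume 0 t := by
  refine intervalIntegrable_of_norm_le_one ?_ fun _ => hb _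
  refine aestronglyMeasurable_of_tendsto_ae atTop
    (fun n => (measurable_gridStep f n).aestronglyMeasurable) ?_
  filter_upwards [ae_restrict_mem measurableSet_uIoc] with s hs
  rw [Set.uIoc_of_le t.coe_nonneg] at hs
  exact tendsto_gridStep hf hs.1.le

theorem tendsto_integral_gridStep {f : ℝ≥0 → ℂ}
    (hf : ∀ t, ContinuousWithinAt f (Set.Ici t) t) (hb : ∀ t, ‖f t‖ ≤ 1) (t : ℝ≥0) :
    Tendsto (fun n => ∫ s in (0 : ℝ)..t, gridStep f n s) atTop
      (𝓝 (∫ s in (0 : ℝ)..t, f s.toNNReal)) := by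
  refine intervalIntegral.tendsto_integral_filter_of_dominated_convergence (fun _ => 1)
    (Eventually.of_forall fun n => (measurable_gridStep f n).aestronglyMeasurable)
    (Eventually.of_forall fun n => ae_of_all _ fun s _ => hb _)
    intervalIntegrable_const (ae_of_all _ fun s hs => ?_)
  rw [Set.uIoc_of_le t.coe_nonneg] at hs
  exact tendsto_gridStep hf hs.1.le

theorem ceil_mul_div_sub_le {n : ℕ} (hn : 0 < n) (t : ℝ≥0) :
    |((⌈t * n⌉₊ : ℕ) : ℝ) / n - t| ≤ 1 / n := by
  have hn' : (0 : ℝ) < n := by exact_mod_cast hn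
  have h1 : (t : ℝ) * n ≤ ⌈t * n⌉₊ := by exact_mod_cast Nat.le_ceil (t * n)
  have h2 : ((⌈t * n⌉₊ : ℕ) : ℝ) ≤ t * n + 1 := by
    exact_mod_cast (Nat.ceil_lt_add_one (zero_le : 0 ≤ t * n)).le
  rw [abs_of_nonneg, sub_le_iff_le_add, div_le_iff₀ hn', add_mul, one_div_mul_cancel hn'.ne']
  · linarith
  · rwa [sub_nonneg, le_div_iff₀ hn']

/-- The left Riemann sums of a bounded right-continuous function over the grid of mesh `1/n`
converge to its integral. No left limits are needed: up to `O(1/n)` the sum equals the integral of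
the step function taking the value of `f` at the right end point of each cell. -/
theorem tendsto_riemannSum_of_rightContinuous {f : ℝ≥0 → ℂ}
    (hf : ∀ t, ContinuousWithinAt f (Set.Ici t) t) (hb : ∀ t, ‖f t‖ ≤ 1) (t : ℝ≥0) :
    Tendsto (fun n : ℕ => (1 / n : ℂ) * ∑ k ∈ Finset.range ⌈t * n⌉₊, f ((k : ℝ≥0) / n)) atTop
      (𝓝 (∫ s in (0 : ℝ)..t, f s.toNNReal)) := by
  refine (tendsto_integral_gridStep hf hb t).congr_dist ?_
  have h3 : Tendsto (fun n : ℕ => (3 : ℝ) * (1 / n)) atTop (𝓝 0) := by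
    simpa using tendsto_one_div_atTop_nhds_zero_nat.const_mul (3 : ℝ)
  refine squeeze_zero' (Eventually.of_forall fun _ => dist_nonneg) ?_ h3
  filter_upwards [eventually_gt_atTop 0] with n hn
  set N := ⌈t * n⌉₊ with hN
  -- shifting the summation index costs the two boundary terms `f 0` and `f (N / n)`
  have hshift : ∑ k ∈ Finset.range N, f ((k : ℝ≥0) / n) =
      ∑ k ∈ Finset.range N, f (((k + 1 : ℕ) : ℝ≥0) / n) - (f ((N : ℝ≥0) / n) - f (0 / n)) := by
    have := Finset.sum_range_sub (fun k : ℕ => f ((k : ℝ≥0) / n)) N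
    rw [Nat.cast_zero] at this
    rw [← this, ← Finset.sum_sub_distrib]
    exact Finset.sum_congr rfl fun k _ => by ring
  have hsplit : (∫ s in (0 : ℝ)..t, gridStep f n s) + ∫ s in (t : ℝ)..(N / n), gridStep f n s =
      ∫ s in (0 : ℝ)..(N / n), gridStep f n s :=
    intervalIntegral.integral_add_adjacent_intervals (intervalIntegrable_gridStep hb n _ _)
      (intervalIntegrable_gridStep hb n _ _)
  have hdiff : (∫ s in (0 : ℝ)..t, gridStep f n s) -
      (1 / n : ℂ) * ∑ k ∈ Finset.range N, f ((k : ℝ≥0) / n) =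
      (1 / n : ℂ) * (f ((N : ℝ≥0) / n) - f (0 / n)) - ∫ s in (t : ℝ)..(N / n), gridStep f n s := by
    rw [hshift, mul_sub, ← integral_gridStep hb hn, ← hsplit]
    ring
  rw [dist_eq_norm, hdiff]
  have h1 : ‖∫ s in (t : ℝ)..(N / n), gridStep f n s‖ ≤ 1 * (1 / n) :=
    (intervalIntegral.norm_integral_le_of_norm_le_const fun _ _ => hb _).trans
      (mul_le_mul_of_nonneg_left (ceil_mul_div_sub_le hn t) zero_le_one)
  have h2 : ‖(1 / n : ℂ) * (f ((N : ℝ≥0) / n) - f (0 / n))‖ ≤ 1 / n * (1 + 1) := by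
    rw [norm_mul, norm_div, norm_one, Complex.norm_natCast]
    gcongr
    exact (norm_sub_le _ _).trans (add_le_add (hb _) (hb _))
  refine (norm_sub_le _ _).trans ((add_le_add h2 h1).trans_eq (by ring))

/-- The Riemann sum over the grid points `k / n < t` with `k < n ^ 2`. The cutoff, void once `t ≤ n`,
makes the range of summation independent of `t`, so that the sum can be integrated term by term
when `t` is random. -/
noncomputable def truncRiemannSum (f : ℝ≥0 → ℂ) (t : ℝ≥0) (n : ℕ) : ℂ :=
  (1 / n : ℂ) * ∑ k ∈ Finset.range (n ^ 2), if (k : ℝ≥0) / n < t then f ((k : ℝ≥0) / n) else 0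

/-- The sum of the increments of `f` over the cells `[k / n, (k + 1) / n]` with `k / n < t` and
`k < n ^ 2`. -/
noncomputable def truncIncrementSum (f : ℝ≥0 → ℂ) (t : ℝ≥0) (n : ℕ) : ℂ :=
  ∑ k ∈ Finset.range (n ^ 2),
    if (k : ℝ≥0) / n < t then f (((k + 1 : ℕ) : ℝ≥0) / n) - f ((k : ℝ≥0) / n) else 0

theorem tendsto_truncRiemannSum {f : ℝ≥0 → ℂ}
    (hf : ∀ t, ContinuousWithinAt f (Set.Ici t) t) (hb : ∀ t, ‖f t‖ ≤ 1) (t : ℝ≥0) :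
    Tendsto (truncRiemannSum f t) atTop (𝓝 (∫ s in (0 : ℝ)..t, f s.toNNReal)) := by
  refine (tendsto_riemannSum_of_rightContinuous hf hb t).congr' ?_
  filter_upwards [eventually_gt_atTop 0, eventually_ge_atTop ⌈t⌉₊] with n hn htn
  rw [truncRiemannSum]
  simp only [natCast_div_lt_iff_lt_ceil hn]
  rw [sum_range_ite_lt (fun k => f ((k : ℝ≥0) / n)), min_eq_left (ceil_mul_le_sq (Nat.ceil_le.1 htn))]

theorem norm_truncRiemannSum_le {f : ℝ≥0 → ℂ} (hb : ∀ t, ‖f t‖ ≤ 1) (t : ℝ≥0) {n : ℕ}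
    (hn : 0 < n) : ‖truncRiemannSum f t n‖ ≤ t + 1 := by
  have hn' : (0 : ℝ) < n := by exact_mod_cast hn
  rw [truncRiemannSum]
  simp only [natCast_div_lt_iff_lt_ceil hn]
  rw [sum_range_ite_lt (fun k => f ((k : ℝ≥0) / n)), norm_mul, norm_div, norm_one,
    Complex.norm_natCast, one_div_mul_eq_div, div_le_iff₀ hn']
  have h1 : ‖∑ k ∈ Finset.range (min ⌈t * n⌉₊ (n ^ 2)), f ((k : ℝ≥0) / n)‖ ≤ ⌈t * n⌉₊ := by
    refine (norm_sum_le_of_le _ fun k _ => hb _).trans ?_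
    simp only [Finset.sum_const, Finset.card_range, nsmul_eq_mul, mul_one]
    exact_mod_cast min_le_left _ _
  have h2 : ((⌈t * n⌉₊ : ℕ) : ℝ) ≤ t * n + 1 := by
    exact_mod_cast (Nat.ceil_lt_add_one (zero_le : 0 ≤ t * n)).le
  have h3 : (1 : ℝ) ≤ n := by exact_mod_cast hn
  linarith

theorem truncIncrementSum_eq (f : ℝ≥0 → ℂ) (t : ℝ≥0) {n : ℕ} (hn : 0 < n) :
    truncIncrementSum f t n = f (((min ⌈t * n⌉₊ (n ^ 2) : ℕ) : ℝ≥0) / n) - f 0 := by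
  rw [truncIncrementSum]
  simp only [natCast_div_lt_iff_lt_ceil hn]
  rw [sum_range_ite_lt (fun k => f (((k + 1 : ℕ) : ℝ≥0) / n) - f ((k : ℝ≥0) / n)),
    Finset.sum_range_sub (fun k : ℕ => f ((k : ℝ≥0) / n))]
  simp

theorem tendsto_truncIncrementSum {f : ℝ≥0 → ℂ} {t : ℝ≥0}
    (hf : ContinuousWithinAt f (Set.Ici t) t) :
    Tendsto (truncIncrementSum f t) atTop (𝓝 (f t - f 0)) := by
  refine ((tendsto_comp_ceil_mul_div hf).sub_const (f 0)).congr' ?_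
  filter_upwards [eventually_gt_atTop 0, eventually_ge_atTop ⌈t⌉₊] with n hn htn
  rw [truncIncrementSum_eq f t hn, min_eq_left (ceil_mul_le_sq (Nat.ceil_le.1 htn))]

theorem norm_truncIncrementSum_le {f : ℝ≥0 → ℂ} (hb : ∀ t, ‖f t‖ ≤ 1) (t : ℝ≥0) {n : ℕ}
    (hn : 0 < n) : ‖truncIncrementSum f t n‖ ≤ 2 := by
  rw [truncIncrementSum_eq f t hn]
  exact (norm_sub_le _ _).trans ((add_le_add (hb _) (hb _)).trans_eq (by norm_num))

/-! ### The characteristic exponent -/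

theorem norm_exp_I_mul_sub_one_sub_le (x : ℝ) :
    ‖Complex.exp (Complex.I * x) - 1 - Complex.I * x‖ ≤ 2 * x ^ 2 := by
  have hx : ‖Complex.I * (x : ℂ)‖ = |x| := by simp
  rcases le_total |x| 1 with h | h
  · have := Complex.norm_exp_sub_one_sub_id_le (x := Complex.I * x) (by rwa [hx])
    rw [hx, sq_abs] at this
    nlinarith [sq_nonneg x]
  · refine (norm_sub_le _ _).trans ?_
    have h1 := Real.norm_exp_I_mul_ofReal_sub_one_le (x := x)
    rw [Real.norm_eq_abs] at h1
    rw [hx, ← sq_abs x]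
    nlinarith

open Classical in
/-- The integrand of the Lévy-Khintchine formula. -/
noncomputable def khintchineIntegrand (u y : ℝ) : ℂ :=
  Complex.exp (Complex.I * u * y) - 1 - (if |y| ≤ 1 then Complex.I * u * y else 0)

theorem norm_khintchineIntegrand_le (u y : ℝ) :
    ‖khintchineIntegrand u y‖ ≤ (2 * u ^ 2 + 2) * min (y ^ 2) 1 := by
  have hI : Complex.I * u * y = Complex.I * ((u * y : ℝ) : ℂ) := by push_cast; ring
  rw [khintchineIntegrand, hI]
  split_ifs with h
  · have h1 : y ^ 2 ≤ 1 := (sq_le_one_iff_abs_le_one y).2 h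
    rw [min_eq_left h1]
    refine (norm_exp_I_mul_sub_one_sub_le _).trans ?_
    nlinarith [sq_nonneg y]
  · have h1 : 1 ≤ y ^ 2 := (one_le_sq_iff_one_le_abs y).2 (not_le.1 h).le
    rw [min_eq_right h1, sub_zero]
    refine (norm_sub_le _ _).trans ?_
    rw [Complex.norm_exp_I_mul_ofReal, norm_one]
    nlinarith [sq_nonneg u]

theorem khintchineIntegrand_re (u y : ℝ) :
    (khintchineIntegrand u y).re = Real.cos (u * y) - 1 := by
  have hI : Complex.I * u * y = ((u * y : ℝ) : ℂ) * Complex.I := by push_cast; ring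
  have hre : (((u * y : ℝ) : ℂ) * Complex.I).re = 0 := by
    rw [Complex.re_ofReal_mul, Complex.I_re, mul_zero]
  rw [khintchineIntegrand, hI]
  split_ifs
  · rw [Complex.sub_re, Complex.sub_re, Complex.exp_ofReal_mul_I_re, hre, Complex.one_re, sub_zero]
  · rw [Complex.sub_re, Complex.sub_re, Complex.exp_ofReal_mul_I_re, Complex.zero_re,
      Complex.one_re, sub_zero]

theorem measurable_khintchineIntegrand :
    Measurable fun p : ℝ × ℝ => khintchineIntegrand p.1 p.2 := by
  unfold khintchineIntegrand
  refine Measurable.sub (by fun_prop) (Measurable.ite ?_ (by fun_prop) measurable_const)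
  exact measurableSet_le (by fun_prop) measurable_const

namespace LevyTriplet

variable (T : LevyTriplet)

theorem integrable_min_sq_one : Integrable (fun y : ℝ => min (y ^ 2) 1) T.ν :=
  (lintegral_ofReal_ne_top_iff_integrable (by fun_prop)
    (ae_of_all _ fun y => le_min (sq_nonneg y) zero_le_one)).1 T.ν_lintegral.ne

theorem sigmaFinite_ν : SigmaFinite T.ν := by
  refine ⟨⟨⟨fun n => {y | 1 / ((n : ℝ) + 1) ≤ ‖min (y ^ 2) 1‖} ∪ {0}, fun _ => trivial,
    fun n => ?_, ?_⟩⟩⟩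
  · refine measure_union_lt_top ?_ (by simp [T.ν_zero])
    exact T.integrable_min_sq_one.measure_norm_ge_lt_top Nat.one_div_pos_of_nat
  · refine Set.eq_univ_of_forall fun y => ?_
    rcases eq_or_ne y 0 with rfl | hy
    · simp
    · have : 0 < ‖min (y ^ 2) 1‖ := norm_pos_iff.2 (lt_min (by positivity) one_pos).ne'
      obtain ⟨n, hn⟩ := exists_nat_one_div_lt this
      exact Set.mem_iUnion.2 ⟨n, Or.inl hn.le⟩

theorem restrict_compl_zero : T.ν.restrict {0}ᶜ = T.ν :=
  Measure.restrict_eq_self_of_ae_mem (by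
    rw [ae_iff]
    simpa using T.ν_zero)

theorem exponent_eq (u : ℝ) :
    T.exponent u = -(1 / 2) * (T.α : ℂ) ^ 2 * (u : ℂ) ^ 2 + Complex.I * u * T.γ +
      ∫ y, khintchineIntegrand u y ∂T.ν := by
  rw [exponent, T.restrict_compl_zero]
  rfl

theorem integrable_khintchineIntegrand (u : ℝ) : Integrable (khintchineIntegrand u) T.ν := by
  refine (T.integrable_min_sq_one.const_mul (2 * u ^ 2 + 2)).mono' ?_
    (ae_of_all _ (norm_khintchineIntegrand_le u))
  exact (measurable_khintchineIntegrand.comp measurable_prodMk_left).aestronglyMeasurable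

theorem measurable_exponent : Measurable T.exponent := by
  have := T.sigmaFinite_ν
  have h : StronglyMeasurable fun u : ℝ => ∫ y, khintchineIntegrand u y ∂T.ν :=
    measurable_khintchineIntegrand.stronglyMeasurable.integral_prod_right
  rw [funext T.exponent_eq]
  exact Measurable.add (by fun_prop) h.measurable

theorem exponent_re (u : ℝ) :
    (T.exponent u).re = -(1 / 2) * T.α ^ 2 * u ^ 2 - ∫ y, (1 - Real.cos (u * y)) ∂T.ν := by
  have h : (∫ y, khintchineIntegrand u y ∂T.ν).re = ∫ y, (Real.cos (u * y) - 1) ∂T.ν := by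
    rw [← RCLike.re_eq_complex_re, ← integral_re (T.integrable_khintchineIntegrand u)]
    simp only [RCLike.re_eq_complex_re, khintchineIntegrand_re]
  have h' : ∫ y, (1 - Real.cos (u * y)) ∂T.ν = -∫ y, (Real.cos (u * y) - 1) ∂T.ν := by
    rw [← integral_neg]
    simp
  have hq : -(1 / 2) * (T.α : ℂ) ^ 2 * (u : ℂ) ^ 2 = ((-(1 / 2) * T.α ^ 2 * u ^ 2 : ℝ) : ℂ) := by
    push_cast; ring
  have hg : (Complex.I * u * T.γ).re = 0 := by simp
  rw [exponent_eq, Complex.add_re, Complex.add_re, h, h', hq, Complex.ofReal_re, hg]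
  ring

theorem integrable_one_sub_cos (u : ℝ) :
    Integrable (fun y => 1 - Real.cos (u * y)) T.ν := by
  refine (T.integrable_khintchineIntegrand u).re.neg.congr (ae_of_all _ fun y => ?_)
  simp [khintchineIntegrand_re]

/-- If the exponent vanishes at `u`, then so does the nonnegative integral of `1 - cos (u y)`,
which confines the Lévy measure to the lattice `(2π / u) ℤ`. -/
theorem ae_cos_eq_one_of_exponent_eq_zero {u : ℝ} (hu : T.exponent u = 0) :
    ∀ᵐ y ∂T.ν, Real.cos (u * y) = 1 := by
  have hnn : ∀ y, 0 ≤ 1 - Real.cos (u * y) := fun y => sub_nonneg.2 (Real.cos_le_one _)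
  have h := T.exponent_re u
  rw [hu, Complex.zero_re] at h
  have h0 : ∫ y, (1 - Real.cos (u * y)) ∂T.ν = 0 := by
    have := integral_nonneg (μ := T.ν) (f := fun y => 1 - Real.cos (u * y)) hnn
    nlinarith [mul_nonneg (sq_nonneg T.α) (sq_nonneg u)]
  filter_upwards [(integral_eq_zero_iff_of_nonneg hnn (T.integrable_one_sub_cos u)).1 h0] with y hy
  exact (sub_eq_zero.1 hy).symm

/-- For almost every `u`, the Lévy measure gives no mass to the lattice `(2π / u) ℤ`: by Tonelli,
since for each `y ≠ 0` only countably many `u` satisfy `cos (u y) = 1`. -/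
theorem ae_ae_cos_ne_one : ∀ᵐ u : ℝ, ∀ᵐ y ∂T.ν, Real.cos (u * y) ≠ 1 := by
  have := T.sigmaFinite_ν
  have hms : MeasurableSet {p : ℝ × ℝ | Real.cos (p.1 * p.2) ≠ 1} :=
    (measurableSet_eq_fun (by fun_prop) measurable_const).compl
  rw [Measure.ae_ae_comm hms]
  have hy0 : ∀ᵐ y ∂T.ν, y ≠ 0 := by
    rw [ae_iff]
    simpa using T.ν_zero
  filter_upwards [hy0] with y hy
  have hc : (Set.range fun n : ℤ => (n : ℝ) * (2 * Real.pi) / y).Countable :=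
    Set.countable_range _
  rw [ae_iff]
  refine (hc.mono fun u hu => ?_).measure_zero volume
  obtain ⟨n, hn⟩ := (Real.cos_eq_one_iff (u * y)).1 (not_not.1 hu)
  exact ⟨n, by simp only [hn]; field_simp⟩

theorem ae_exponent_ne_zero (hT : T.Nontrivial) : ∀ᵐ u : ℝ, T.exponent u ≠ 0 := by
  by_cases hν : T.ν = 0
  · filter_upwards [Measure.ae_ne volume (0 : ℝ)] with u hu h0
    have hexp := T.exponent_eq u
    rw [hν, integral_zero_measure, add_zero, h0] at hexp
    have hre := congrArg Complex.re hexp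
    have him := congrArg Complex.im hexp
    simp [sq, hu] at hre him
    exact hT ⟨hre, him, hν⟩
  · filter_upwards [T.ae_ae_cos_ne_one] with u hu h0
    have : ∀ᵐ _ ∂T.ν, False := by
      filter_upwards [hu, T.ae_cos_eq_one_of_exponent_eq_zero h0] with y h1 h2 using h1 h2
    exact hν (by simpa [ae_eq_bot] using this)

end LevyTriplet

/-! ### Independence of future increments from the past -/

variable {Ω : Type*} {mΩ : MeasurableSpace Ω} {P : Measure Ω}

/-- If `X` is independent of `(Y, Z)` and `Y` is independent of `Z`, then `(X, Y)` is independent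
of `Z`. -/
theorem indepFun_prodMk_of_indepFun_prodMk {α β γ : Type*} [MeasurableSpace α] [MeasurableSpace β]
    [MeasurableSpace γ] [IsProbabilityMeasure P] {X : Ω → α} {Y : Ω → β} {Z : Ω → γ}
    (hX : Measurable X) (hY : Measurable Y) (hZ : Measurable Z)
    (h : IndepFun X (fun ω => (Y ω, Z ω)) P) (hYZ : IndepFun Y Z P) :
    IndepFun (fun ω => (X ω, Y ω)) Z P := by
  have hXY : IndepFun X Y P := h.comp measurable_id measurable_fst
  have h1 := (indepFun_iff_map_prod_eq_prod_map_map hX.aemeasurable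
    (hY.prodMk hZ).aemeasurable).1 h
  have h2 := (indepFun_iff_map_prod_eq_prod_map_map hY.aemeasurable hZ.aemeasurable).1 hYZ
  have h3 := (indepFun_iff_map_prod_eq_prod_map_map hX.aemeasurable hY.aemeasurable).1 hXY
  have := Measure.isProbabilityMeasure_map (μ := P) hX.aemeasurable
  have := Measure.isProbabilityMeasure_map (μ := P) hY.aemeasurable
  have := Measure.isProbabilityMeasure_map (μ := P) hZ.aemeasurable
  rw [indepFun_iff_map_prod_eq_prod_map_map (hX.prodMk hY).aemeasurable hZ.aemeasurable, h3]
  have h4 := Measure.prodAssoc_prod (μ := P.map X) (ν := P.map Y) (τ := P.map Z)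
  rw [← h2, ← h1] at h4
  have h5 := congrArg (Measure.map MeasurableEquiv.prodAssoc.symm) h4
  rw [Measure.map_map (by fun_prop) (by fun_prop), Measure.map_map (by fun_prop) (by fun_prop)] at h5
  simp only [MeasurableEquiv.symm_comp_self, Measure.map_id] at h5
  rw [h5]
  rfl

/-- The times `0, t₁, …, tₙ, t, r, r, …`, where `t₁ < … < tₙ` are the elements of `I`. -/
noncomputable def timeChain (I : Finset ℝ≥0) (t r : ℝ≥0) : ℕ → ℝ≥0
  | 0 => 0
  | j + 1 => if h : j < I.card then I.orderEmbOfFin rfl ⟨j, h⟩ else if j = I.card then t else r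

theorem monotone_timeChain {I : Finset ℝ≥0} {t r : ℝ≥0} (hI : ∀ s ∈ I, s ≤ t) (htr : t ≤ r) :
    Monotone (timeChain I t r) := by
  refine monotone_nat_of_le_succ fun j => ?_
  cases j with
  | zero => exact zero_le
  | succ j =>
    by_cases h1 : j + 1 < I.card
    · have h2 : j < I.card := by omega
      simp only [timeChain, h1, h2, dif_pos]
      exact (I.orderEmbOfFin rfl).monotone (by simp)
    · by_cases h2 : j < I.card
      · have h3 : j + 1 = I.card := by omega
        simp only [timeChain, h2, h3, dif_pos, lt_irrefl, if_true, dif_neg, not_false_eq_true]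
        exact hI _ (I.orderEmbOfFin_mem rfl _)
      · have h3 : ¬ j + 1 = I.card := by omega
        simp only [timeChain, h1, h2, h3, dif_neg, if_false, not_false_eq_true]
        split_ifs
        · exact htr
        · exact le_rfl

theorem exists_timeChain_eq {I : Finset ℝ≥0} (t r : ℝ≥0) {s : ℝ≥0} (hs : s ∈ I) :
    ∃ j < I.card, timeChain I t r (j + 1) = s := by
  have : s ∈ Set.range (I.orderEmbOfFin rfl) := by rwa [I.range_orderEmbOfFin rfl]
  obtain ⟨⟨j, hj⟩, rfl⟩ := this
  exact ⟨j, hj, by simp [timeChain, hj]⟩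

/-- Finitely many values of a process with independent increments, up to time `t`, are sums of
increments over a chain of times, hence independent of an increment after `t`. -/
theorem indepFun_finset_increment [IsProbabilityMeasure P] {X : ℝ≥0 → Ω → ℝ}
    (hm : ∀ t, Measurable (X t)) (h0 : ∀ᵐ ω ∂P, X 0 ω = 0) (hX : HasIndepIncrements X P)
    {t r : ℝ≥0} (htr : t ≤ r) {I : Finset ℝ≥0} (hI : ∀ s ∈ I, s ≤ t) :
    IndepFun (fun ω (s : I) => X s ω) (fun ω => X r ω - X t ω) P := by
  have hind := (hX.nat (monotone_timeChain hI htr)).indepFun_finset (Finset.range (I.card + 1))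
    {I.card + 1} (by simp) fun i => (hm _).sub (hm _)
  choose! j hj hju using fun s (hs : s ∈ I) => exists_timeChain_eq t r hs
  -- the value at `s` is the sum of the increments up to the position of `s` in the chain
  let φ : ((Finset.range (I.card + 1)) → ℝ) → (I → ℝ) := fun x s =>
    ∑ i ∈ (Finset.range (j s + 1)).attach,
      if h : i.1 ∈ Finset.range (I.card + 1) then x ⟨i.1, h⟩ else 0
  have hφ : Measurable φ := by
    refine measurable_pi_lambda _ fun s => Finset.measurable_sum _ fun i _ => ?_
    split_ifs
    · fun_prop
    · fun_prop
  let ψ : (({I.card + 1} : Finset ℕ) → ℝ) → ℝ := fun x => x ⟨I.card + 1, by simp⟩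
  have hψ : Measurable ψ := measurable_pi_apply _
  refine (hind.comp hφ hψ).congr ?_ (ae_of_all _ fun ω => ?_)
  · filter_upwards [h0] with ω hω
    funext s
    have hmem : ∀ i ∈ Finset.range (j s + 1), i ∈ Finset.range (I.card + 1) := fun i hi => by
      have := hj s s.2
      simp only [Finset.mem_range] at hi ⊢
      omega
    have hsum := Finset.sum_range_sub (fun i => X (timeChain I t r i) ω) (j s + 1)
    rw [hju s s.2, show timeChain I t r 0 = 0 from rfl, hω, sub_zero] at hsum
    rw [← hsum, ← Finset.sum_attach]
    refine Finset.sum_congr rfl fun i _ => ?_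
    simp only [hmem i.1 i.2, dif_pos]
  · simp [ψ, timeChain]

/-- For a Lévy process started from an independent initial value, the path up to time `t` is
independent of the increments after `t`. -/
theorem indepFun_past_increment [IsProbabilityMeasure P] {X L : ℝ≥0 → Ω → ℝ} {X₀ : Ω → ℝ}
    (hX : IsLevyProcess X P) (hX₀ : Measurable X₀)
    (hind : IndepFun X₀ (fun ω (t : ℝ≥0) => X t ω) P) (hL : ∀ t ω, L t ω = X t ω + X₀ ω)
    {t r : ℝ≥0} (htr : t ≤ r) :
    IndepFun (fun ω (s : Set.Iic t) => L s ω) (fun ω => X r ω - X t ω) P := by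
  have hpast : IndepFun (fun ω (s : Set.Iic t) => X s ω) (fun ω => X r ω - X t ω) P := by
    refine IndepFun.process_indepFun (fun s => hX.measurable s)
      ((hX.measurable r).sub (hX.measurable t)) fun I => ?_
    have h := indepFun_finset_increment hX.measurable hX.start_zero hX.indep htr
      (I := I.map ⟨Subtype.val, Subtype.val_injective⟩) (by
        intro s hs
        obtain ⟨a, -, rfl⟩ := Finset.mem_map.1 hs
        exact a.2)
    exact h.comp (φ := fun x (i : I) => x ⟨i.1.1, Finset.mem_map_of_mem _ i.2⟩) (ψ := id)
      (measurable_pi_lambda _ fun i => measurable_pi_apply _) measurable_id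
  have hjoint : IndepFun X₀
      (fun ω => ((fun s : Set.Iic t => X s ω), X r ω - X t ω)) P :=
    hind.comp (φ := id)
      (ψ := fun x : ℝ≥0 → ℝ => ((fun s : Set.Iic t => x s), x r - x t)) measurable_id
      ((measurable_pi_lambda _ fun s => measurable_pi_apply _).prodMk
        ((measurable_pi_apply _).sub (measurable_pi_apply _)))
  have h := indepFun_prodMk_of_indepFun_prodMk hX₀
    (measurable_pi_lambda _ fun s => hX.measurable _)
    ((hX.measurable r).sub (hX.measurable t)) hjoint hpast
  have h' := h.comp (φ := fun p : ℝ × (Set.Iic t → ℝ) => fun s => p.2 s + p.1) (ψ := id)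
    (by fun_prop) measurable_id
  have hfun : (fun ω (s : Set.Iic t) => L s ω) =
      (fun p : ℝ × (Set.Iic t → ℝ) => fun s => p.2 s + p.1) ∘
        fun ω => (X₀ ω, fun s : Set.Iic t => X s ω) := by
    funext ω s
    exact hL s ω
  rw [hfun]
  exact h'

theorem measurable_exp_I_mul (u : ℝ) : Measurable fun x : ℝ => Complex.exp (Complex.I * u * x) := by
  fun_prop

theorem norm_exp_I_mul (u x : ℝ) : ‖Complex.exp (Complex.I * u * x)‖ = 1 := by
  rw [mul_assoc, ← Complex.ofReal_mul, Complex.norm_exp_I_mul_ofReal]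

theorem integral_exp_increment {X : ℝ≥0 → Ω → ℝ} {T : LevyTriplet}
    (hX : IsLevyProcess X P) (hT : HasLevyTriplet X T P) (t d : ℝ≥0) (u : ℝ) :
    ∫ ω, Complex.exp (Complex.I * u * ((X (t + d) ω - X t ω : ℝ) : ℂ)) ∂P =
      Complex.exp ((d : ℝ) * T.exponent u) := by
  have h := ((hX.stationary t d).comp (measurable_exp_I_mul u)).integral_eq
  simp only [Function.comp_def] at h
  rw [h, ← hT d u]
  refine integral_congr_ae ?_
  filter_upwards [hX.start_zero] with ω hω
  rw [hω, sub_zero]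

/-- The Markov property in Fourier form: over an event of the augmented past at time `t`, the mean
of `e^{iuL}` is multiplied by `e^{dη(u)}` between the times `t` and `t + d`. -/
theorem setIntegral_exp_add [IsProbabilityMeasure P] [P.IsComplete] {L : ℝ≥0 → Ω → ℝ}
    {T : LevyTriplet} {μ₀ : Measure ℝ} (hL : IsLevyProcessFrom L T μ₀ P) (t d : ℝ≥0) (u : ℝ)
    {S : Set Ω} (hS : MeasurableSet[augmentedFiltration P L hL.stronglyMeasurable t] S) :
    ∫ ω in S, Complex.exp (Complex.I * u * L (t + d) ω) ∂P =
      Complex.exp ((d : ℝ) * T.exponent u) *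
        ∫ ω in S, Complex.exp (Complex.I * u * L t ω) ∂P := by
  obtain ⟨B, hB, hSB⟩ := hS
  have hLm := hL.stronglyMeasurable
  have hBm : MeasurableSet B := (Filtration.natural L hLm).le t B hB
  rw [setIntegral_congr_set hSB, setIntegral_congr_set hSB]
  rw [Filtration.natural_eq_comap] at hB
  obtain ⟨C, hC, rfl⟩ := hB
  obtain ⟨X, X₀, hX, hXT, hX₀, -, hind, hLX⟩ := hL
  have hi := indepFun_past_increment hX hX₀ hind hLX (le_self_add : t ≤ t + d)
  let φ : (Set.Iic t → ℝ) → ℂ :=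
    C.indicator fun x => Complex.exp (Complex.I * u * x ⟨t, Set.self_mem_Iic⟩)
  have hφ : Measurable φ := Measurable.indicator (by fun_prop) hC
  have hi' := hi.comp hφ (measurable_exp_I_mul u)
  have hmA : Measurable fun ω (s : Set.Iic t) => L s ω :=
    measurable_pi_lambda _ fun s => (hLm s).measurable
  have hprod := hi'.integral_mul_eq_mul_integral (hφ.comp hmA).aestronglyMeasurable
    ((measurable_exp_I_mul u).comp
      ((hX.measurable (t + d)).sub (hX.measurable t))).aestronglyMeasurable
  rw [← integral_indicator hBm, ← integral_indicator hBm]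
  have hinc := integral_exp_increment hX hXT t d u
  simp only [Function.comp_def] at hprod
  rw [hinc] at hprod
  refine (integral_congr_ae (ae_of_all _ fun ω => ?_)).trans
    ((hprod.trans (mul_comm _ _)).trans (congrArg _ (integral_congr_ae (ae_of_all _ fun ω => ?_))))
  · by_cases hω : (fun s : Set.Iic t => L s ω) ∈ C
    · simp only [Pi.mul_apply, φ]
      rw [Set.indicator_of_mem hω, Set.indicator_of_mem (by exact hω), ← Complex.exp_add]
      dsimp only
      rw [hLX, hLX]
      congr 1
      push_cast
      ring
    · simp only [Pi.mul_apply, φ]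
      rw [Set.indicator_of_notMem hω, Set.indicator_of_notMem (by exact hω), zero_mul]
  · rfl

/-! ### Laws and Fourier transforms -/

theorem integral_exp_of_hasLaw_density {Y : Ω → ℝ} {h : ℝ → ℝ} (hm : Measurable h)
    (hpos : ∀ x, 0 ≤ h x) (hY : HasLaw Y (densityMeasure h) P) (u : ℝ) :
    ∫ ω, Complex.exp (Complex.I * u * Y ω) ∂P = fourierHat h u := by
  have h1 := hY.integral_comp (measurable_exp_I_mul u).aestronglyMeasurable
  simp only [Function.comp_def] at h1
  rw [h1, densityMeasure, integral_withDensity_eq_integral_toReal_smul hm.ennreal_ofReal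
    (ae_of_all _ fun _ => ENNReal.ofReal_lt_top), fourierHat]
  refine integral_congr_ae (ae_of_all _ fun x => ?_)
  simp only [ENNReal.toReal_ofReal (hpos x), Complex.real_smul, mul_comm]

theorem measurable_fourierHat {h : ℝ → ℝ} (hm : Measurable h) : Measurable (fourierHat h) := by
  have : Measurable fun p : ℝ × ℝ => Complex.exp (Complex.I * p.1 * p.2) * (h p.2 : ℂ) := by
    fun_prop
  exact this.stronglyMeasurable.integral_prod_right.measurable

/-! ### Optional stopping -/

/-- The path `t ↦ e^{iuL_t(ω)}`. -/
noncomputable def expPath (L : ℝ≥0 → Ω → ℝ) (u : ℝ) (ω : Ω) (t : ℝ≥0) : ℂ :=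
  Complex.exp (Complex.I * u * L t ω)

theorem norm_expPath_le (L : ℝ≥0 → Ω → ℝ) (u : ℝ) (ω : Ω) (t : ℝ≥0) : ‖expPath L u ω t‖ ≤ 1 :=
  (norm_exp_I_mul _ _).le

theorem integrable_expPath [IsProbabilityMeasure P] {L : ℝ≥0 → Ω → ℝ}
    (hL : ∀ t, StronglyMeasurable (L t)) (u : ℝ) (t : ℝ≥0) :
    Integrable (fun ω => expPath L u ω t) P :=
  .of_bound ((measurable_exp_I_mul u).comp (hL t).measurable).aestronglyMeasurable 1
    (ae_of_all _ fun _ => norm_expPath_le _ _ _ _)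

theorem IsLevyProcessFrom.ae_continuousWithinAt_expPath {L : ℝ≥0 → Ω → ℝ} {T : LevyTriplet}
    {μ₀ : Measure ℝ} (hL : IsLevyProcessFrom L T μ₀ P) (u : ℝ) :
    ∀ᵐ ω ∂P, ∀ t, ContinuousWithinAt (expPath L u ω) (Set.Ici t) t := by
  obtain ⟨X, X₀, hX, -, -, -, -, hLX⟩ := hL
  filter_upwards [hX.rcll] with ω hω t
  have hLc : ContinuousWithinAt (fun s => L s ω) (Set.Ici t) t := by
    simp only [hLX]
    exact (hω t).1.add continuousWithinAt_const
  have hc : Continuous fun x : ℝ => Complex.exp (Complex.I * u * x) := by fun_prop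
  exact hc.continuousAt.comp_continuousWithinAt hLc

theorem IsLevyProcessFrom.hasLaw_zero {L : ℝ≥0 → Ω → ℝ} {T : LevyTriplet}
    {μ₀ : Measure ℝ} (hL : IsLevyProcessFrom L T μ₀ P) : HasLaw (L 0) μ₀ P := by
  obtain ⟨X, X₀, hX, -, -, hlaw, -, hLX⟩ := hL
  refine hlaw.congr ?_
  filter_upwards [hX.start_zero] with ω hω
  rw [hLX, hω, zero_add]

theorem stoppedValue_of_lt_top (L : ℝ≥0 → Ω → ℝ) {τ : Ω → ℝ≥0∞} {ω : Ω} (h : τ ω < ∞) :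
    stoppedValue L τ ω = L (τ ω).toNNReal ω := by
  unfold stoppedValue
  generalize τ ω = x at h
  lift x to ℝ≥0 using h.ne
  rfl

theorem measurable_of_isStoppingTime {𝓕 : Filtration ℝ≥0 mΩ} {τ : Ω → ℝ≥0∞}
    (hτ : IsStoppingTime 𝓕 τ) : Measurable τ := by
  refine measurable_of_Iic fun x => ?_
  induction x with
  | top => simp
  | coe t => exact 𝓕.le t _ (hτ t)

theorem measurableSet_coe_lt {𝓕 : Filtration ℝ≥0 mΩ} {τ : Ω → ℝ≥0∞}
    (hτ : IsStoppingTime 𝓕 τ) (t : ℝ≥0) : MeasurableSet[𝓕 t] {ω | (t : ℝ≥0∞) < τ ω} :=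
  hτ.measurableSet_gt t

theorem truncRiemannSum_eq_sum_indicator {L : ℝ≥0 → Ω → ℝ} {τ : Ω → ℝ≥0∞} {ω : Ω}
    (h : τ ω < ∞) (u : ℝ) (n : ℕ) :
    truncRiemannSum (expPath L u ω) (τ ω).toNNReal n =
      (1 / n : ℂ) * ∑ k ∈ Finset.range (n ^ 2),
        {ω | (((k : ℝ≥0) / n : ℝ≥0) : ℝ≥0∞) < τ ω}.indicator
          (fun ω => expPath L u ω ((k : ℝ≥0) / n)) ω := by
  rw [truncRiemannSum]
  congr 1
  refine Finset.sum_congr rfl fun k _ => ?_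
  rw [Set.indicator_apply]
  simp only [Set.mem_ofPred_eq]
  congr 1
  rw [← ENNReal.coe_lt_coe, ENNReal.coe_toNNReal h.ne]

theorem truncIncrementSum_eq_sum_indicator {L : ℝ≥0 → Ω → ℝ} {τ : Ω → ℝ≥0∞} {ω : Ω}
    (h : τ ω < ∞) (u : ℝ) (n : ℕ) :
    truncIncrementSum (expPath L u ω) (τ ω).toNNReal n =
      ∑ k ∈ Finset.range (n ^ 2), {ω | (((k : ℝ≥0) / n : ℝ≥0) : ℝ≥0∞) < τ ω}.indicator
        (fun ω => expPath L u ω (((k + 1 : ℕ) : ℝ≥0) / n) - expPath L u ω ((k : ℝ≥0) / n)) ω := by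
  rw [truncIncrementSum]
  refine Finset.sum_congr rfl fun k _ => ?_
  rw [Set.indicator_apply]
  simp only [Set.mem_ofPred_eq]
  congr 1
  rw [← ENNReal.coe_lt_coe, ENNReal.coe_toNNReal h.ne]

section

variable {T : LevyTriplet} {L : ℝ≥0 → Ω → ℝ}
  {μ₀ : Measure ℝ} {τ : Ω → ℝ≥0∞}

/-- Discrete optional stopping: as `{k / n < τ}` lies in the past at time `k / n`, the mean
increment over the next cell is `e^{η/n} - 1` times the mean of the value at `k / n`. -/
theorem integral_truncIncrementSum [IsProbabilityMeasure P] [P.IsComplete]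
    (hL : IsLevyProcessFrom L T μ₀ P)
    (hτ : IsStoppingTime (augmentedFiltration P L hL.stronglyMeasurable) τ)
    (hfin : ∀ᵐ ω ∂P, τ ω < ∞) (u : ℝ) {n : ℕ} (hn : 0 < n) :
    ∫ ω, truncIncrementSum (expPath L u ω) (τ ω).toNNReal n ∂P =
      (n * (Complex.exp (T.exponent u / n) - 1)) *
        ∫ ω, truncRiemannSum (expPath L u ω) (τ ω).toNNReal n ∂P := by
  have hn' : (n : ℂ) ≠ 0 := by exact_mod_cast hn.ne'
  have hint := integrable_expPath (P := P) hL.stronglyMeasurable u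
  have hint' : ∀ k : ℕ, Integrable
      (fun ω => expPath L u ω (((k + 1 : ℕ) : ℝ≥0) / n) - expPath L u ω ((k : ℝ≥0) / n)) P :=
    fun k => (hint _).sub (hint _)
  have hA : ∀ k : ℕ, MeasurableSet {ω | (((k : ℝ≥0) / n : ℝ≥0) : ℝ≥0∞) < τ ω} := fun k =>
    (augmentedFiltration P L hL.stronglyMeasurable).le _ _ (measurableSet_coe_lt hτ _)
  rw [integral_congr_ae (hfin.mono fun ω hω => truncIncrementSum_eq_sum_indicator hω u n),
    integral_congr_ae (hfin.mono fun ω hω => truncRiemannSum_eq_sum_indicator hω u n),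
    integral_const_mul, integral_finsetSum _ fun k _ => (hint' k).indicator (hA k),
    integral_finsetSum _ fun k _ => (hint _).indicator (hA k), ← mul_assoc, Finset.mul_sum]
  refine Finset.sum_congr rfl fun k _ => ?_
  have hstep := setIntegral_exp_add hL ((k : ℝ≥0) / n) (1 / n) u (measurableSet_coe_lt hτ _)
  have hsum : (k : ℝ≥0) / n + 1 / n = ((k + 1 : ℕ) : ℝ≥0) / n := by push_cast; ring
  have hexp : (((1 / n : ℝ≥0) : ℝ) : ℂ) * T.exponent u = T.exponent u / n := by
    push_cast; ring
  rw [hsum, hexp] at hstep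
  rw [integral_indicator (hA k), integral_indicator (hA k),
    integral_sub (hint _).integrableOn (hint _).integrableOn]
  simp only [expPath]
  rw [hstep]
  field_simp

theorem tendsto_natCast_mul_exp_div_sub_one (z : ℂ) :
    Tendsto (fun n : ℕ => (n : ℂ) * (Complex.exp (z / n) - 1)) atTop (𝓝 z) := by
  have hd : HasDerivAt (fun t : ℝ => Complex.exp ((t : ℂ) * z)) z 0 := by
    have := ((Complex.ofRealCLM.hasDerivAt (x := (0 : ℝ))).mul_const z).cexp
    simpa using this
  have h := hd.tendsto_slope_zero.comp (tendsto_nhdsWithin_iff.2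
    ⟨tendsto_one_div_atTop_nhds_zero_nat (𝕜 := ℝ), by
      filter_upwards [eventually_gt_atTop 0] with n hn
      simp [hn.ne']⟩)
  refine h.congr fun n => ?_
  simp [div_eq_mul_inv, mul_comm]

theorem aestronglyMeasurable_truncRiemannSum (hL : ∀ t, StronglyMeasurable (L t))
    (hτm : Measurable τ) (u : ℝ) (n : ℕ) :
    AEStronglyMeasurable (fun ω => truncRiemannSum (expPath L u ω) (τ ω).toNNReal n) P := by
  refine Measurable.aestronglyMeasurable ?_
  refine (Finset.measurable_sum _ fun k _ => Measurable.ite ?_ ?_ measurable_const).const_mul _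
  · exact measurableSet_lt measurable_const hτm.ennreal_toNNReal
  · exact (measurable_exp_I_mul u).comp (hL _).measurable

theorem aestronglyMeasurable_truncIncrementSum (hL : ∀ t, StronglyMeasurable (L t))
    (hτm : Measurable τ) (u : ℝ) (n : ℕ) :
    AEStronglyMeasurable (fun ω => truncIncrementSum (expPath L u ω) (τ ω).toNNReal n) P := by
  refine Measurable.aestronglyMeasurable ?_
  refine Finset.measurable_sum _ fun k _ => Measurable.ite ?_ ?_ measurable_const
  · exact measurableSet_lt measurable_const hτm.ennreal_toNNReal
  · exact ((measurable_exp_I_mul u).comp (hL _).measurable).sub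
      ((measurable_exp_I_mul u).comp (hL _).measurable)

theorem norm_expPathIntegral_le (L : ℝ≥0 → Ω → ℝ) (τ : Ω → ℝ≥0∞) (u : ℝ) (ω : Ω) :
    ‖expPathIntegral L τ u ω‖ ≤ (τ ω).toReal := by
  have h := intervalIntegral.norm_integral_le_of_norm_le_const (a := 0) (b := (τ ω).toReal)
    (C := 1) (f := fun s : ℝ => Complex.exp (Complex.I * u * L s.toNNReal ω))
    fun s _ => (norm_exp_I_mul _ _).le
  rwa [one_mul, sub_zero, abs_of_nonneg ENNReal.toReal_nonneg] at h

theorem ae_tendsto_truncRiemannSum (hL : IsLevyProcessFrom L T μ₀ P) (τ : Ω → ℝ≥0∞) (u : ℝ) :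
    ∀ᵐ ω ∂P, Tendsto (truncRiemannSum (expPath L u ω) (τ ω).toNNReal) atTop
      (𝓝 (expPathIntegral L τ u ω)) := by
  filter_upwards [hL.ae_continuousWithinAt_expPath u] with ω hω
  exact tendsto_truncRiemannSum hω (norm_expPath_le L u ω) _

theorem integrable_expPathIntegral (hL : IsLevyProcessFrom L T μ₀ P) (hτm : Measurable τ)
    (hmean : ∫⁻ ω, τ ω ∂P < ∞) (u : ℝ) : Integrable (expPathIntegral L τ u) P :=
  (integrable_toReal_of_lintegral_ne_top hτm.aemeasurable hmean.ne).mono'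
    (aestronglyMeasurable_of_tendsto_ae atTop
      (aestronglyMeasurable_truncRiemannSum hL.stronglyMeasurable hτm u)
      (ae_tendsto_truncRiemannSum hL τ u))
    (ae_of_all _ (norm_expPathIntegral_le L τ u))

theorem norm_integral_expPathIntegral_le (hτm : Measurable τ) (hmean : ∫⁻ ω, τ ω ∂P < ∞) (u : ℝ) :
    ‖∫ ω, expPathIntegral L τ u ω ∂P‖ ≤ ∫ ω, (τ ω).toReal ∂P :=
  norm_integral_le_of_norm_le (integrable_toReal_of_lintegral_ne_top hτm.aemeasurable hmean.ne)
    (ae_of_all _ (norm_expPathIntegral_le L τ u))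

/-- Optional stopping for the martingale `e^{iuL_t} - η(u) ∫₀^t e^{iuL_s} ds` at a stopping time
of finite mean, obtained as the limit of its discrete version. -/
theorem exponent_mul_integral_expPathIntegral [IsProbabilityMeasure P] [P.IsComplete]
    (hL : IsLevyProcessFrom L T μ₀ P)
    (hτ : IsStoppingTime (augmentedFiltration P L hL.stronglyMeasurable) τ)
    (hmean : ∫⁻ ω, τ ω ∂P < ∞) (u : ℝ) :
    T.exponent u * ∫ ω, expPathIntegral L τ u ω ∂P =
      (∫ ω, Complex.exp (Complex.I * u * stoppedValue L τ ω) ∂P) -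
        ∫ ω, Complex.exp (Complex.I * u * L 0 ω) ∂P := by
  have hτm := measurable_of_isStoppingTime hτ
  have hfin : ∀ᵐ ω ∂P, τ ω < ∞ := ae_lt_top hτm hmean.ne
  have hRC := hL.ae_continuousWithinAt_expPath u
  have hLm := hL.stronglyMeasurable
  have hpos : ∀ᶠ n : ℕ in atTop, 0 < n := eventually_gt_atTop 0
  have hlim1 : Tendsto (fun n => ∫ ω, truncRiemannSum (expPath L u ω) (τ ω).toNNReal n ∂P) atTop
      (𝓝 (∫ ω, expPathIntegral L τ u ω ∂P)) := by
    refine tendsto_integral_filter_of_dominated_convergence (fun ω => (τ ω).toReal + 1)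
      (Eventually.of_forall (aestronglyMeasurable_truncRiemannSum hLm hτm u)) ?_
      ((integrable_toReal_of_lintegral_ne_top hτm.aemeasurable hmean.ne).add
        (integrable_const 1)) (ae_tendsto_truncRiemannSum hL τ u)
    filter_upwards [hpos] with n hn
    exact ae_of_all _ fun ω => norm_truncRiemannSum_le (norm_expPath_le L u ω) _ hn
  have hlim2 : Tendsto (fun n => ∫ ω, truncIncrementSum (expPath L u ω) (τ ω).toNNReal n ∂P) atTop
      (𝓝 (∫ ω, (expPath L u ω (τ ω).toNNReal - expPath L u ω 0) ∂P)) := by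
    refine tendsto_integral_filter_of_dominated_convergence (fun _ => 2)
      (Eventually.of_forall (aestronglyMeasurable_truncIncrementSum hLm hτm u)) ?_
      (integrable_const 2) ?_
    · filter_upwards [hpos] with n hn
      exact ae_of_all _ fun ω => norm_truncIncrementSum_le (norm_expPath_le L u ω) _ hn
    · filter_upwards [hRC] with ω hω
      exact tendsto_truncIncrementSum (hω _)
  have hlim3 := (tendsto_natCast_mul_exp_div_sub_one (T.exponent u)).mul hlim1
  have heq := tendsto_nhds_unique hlim3 (hlim2.congr' (by
    filter_upwards [hpos] with n hn using integral_truncIncrementSum hL hτ hfin u hn))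
  have hvalue : ∀ᵐ ω ∂P, expPath L u ω (τ ω).toNNReal =
      Complex.exp (Complex.I * u * stoppedValue L τ ω) := by
    filter_upwards [hfin] with ω hω
    rw [stoppedValue_of_lt_top L hω, expPath]
  have hmeas : AEStronglyMeasurable (fun ω => expPath L u ω (τ ω).toNNReal) P := by
    -- the stopped path is the limit of the increment sums plus the initial value
    refine aestronglyMeasurable_of_tendsto_ae atTop (f := fun n ω =>
      truncIncrementSum (expPath L u ω) (τ ω).toNNReal n + expPath L u ω 0)
      (fun n => (aestronglyMeasurable_truncIncrementSum hLm hτm u n).add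
        (integrable_expPath hLm u 0).aestronglyMeasurable) ?_
    filter_upwards [hRC] with ω hω
    simpa using (tendsto_truncIncrementSum (hω (τ ω).toNNReal)).add_const (expPath L u ω 0)
  have hint : Integrable (fun ω => expPath L u ω (τ ω).toNNReal) P :=
    .of_bound hmeas 1 (ae_of_all _ fun _ => norm_expPath_le _ _ _ _)
  rw [heq, integral_sub hint (integrable_expPath hLm u 0), integral_congr_ae hvalue]
  rfl

end

end SkorokhodLevy

theorem mainTheorem3 {Ω : Type*} {mΩ : MeasurableSpace Ω} (P : Measure Ω)
    [IsProbabilityMeasure P] [P.IsComplete]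
    (T : SkorokhodLevy.LevyTriplet) (hT : T.Nontrivial)
    (h₀ h₁ : ℝ → ℝ) (hm₀ : Measurable h₀) (hm₁ : Measurable h₁)
    (hpos₀ : ∀ x, 0 ≤ h₀ x) (hpos₁ : ∀ x, 0 ≤ h₁ x)
    (L : ℝ≥0 → Ω → ℝ)
    (hL : SkorokhodLevy.IsLevyProcessFrom L T (SkorokhodLevy.densityMeasure h₀) P)
    (τ : Ω → ℝ≥0∞)
    (hτ : SkorokhodLevy.IsFiniteMeanEmbedding P
      (SkorokhodLevy.augmentedFiltration P L hL.stronglyMeasurable) L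
      (SkorokhodLevy.densityMeasure h₁) τ) :
    (∀ u : ℝ,
      (∀ᵐ ω ∂P, τ ω < ∞ ∧ IntervalIntegrable
        (fun s : ℝ => Complex.exp (Complex.I * u * L s.toNNReal ω)) volume 0 (τ ω).toReal) ∧
      Integrable (SkorokhodLevy.expPathIntegral L τ u) P ∧
      T.exponent u * ∫ ω, SkorokhodLevy.expPathIntegral L τ u ω ∂P =
        SkorokhodLevy.fourierHat h₁ u - SkorokhodLevy.fourierHat h₀ u) ∧
    (∀ᵐ u : ℝ, T.exponent u ≠ 0) ∧
    ∀ R : ℝ, 0 < R → IntegrableOn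
      (fun u : ℝ => (SkorokhodLevy.fourierHat h₁ u - SkorokhodLevy.fourierHat h₀ u) /
        T.exponent u) {u : ℝ | |u| ≤ R} volume := by
  have hτm := SkorokhodLevy.measurable_of_isStoppingTime hτ.isStoppingTime
  have hid : ∀ u : ℝ, T.exponent u * ∫ ω, SkorokhodLevy.expPathIntegral L τ u ω ∂P =
      SkorokhodLevy.fourierHat h₁ u - SkorokhodLevy.fourierHat h₀ u := fun u => by
    rw [SkorokhodLevy.exponent_mul_integral_expPathIntegral hL hτ.isStoppingTime hτ.finite_mean u,
      SkorokhodLevy.integral_exp_of_hasLaw_density hm₁ hpos₁ hτ.hasLaw,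
      SkorokhodLevy.integral_exp_of_hasLaw_density hm₀ hpos₀ hL.hasLaw_zero]
  have hne := T.ae_exponent_ne_zero hT
  refine ⟨fun u => ⟨?_, SkorokhodLevy.integrable_expPathIntegral hL hτm hτ.finite_mean u, hid u⟩,
    hne, fun R _ => ?_⟩
  · filter_upwards [ae_lt_top hτm hτ.finite_mean.ne, hL.ae_continuousWithinAt_expPath u]
      with ω hω hc
    exact ⟨hω, SkorokhodLevy.intervalIntegrable_of_rightContinuous hc
      (SkorokhodLevy.norm_expPath_le L u ω) (τ ω).toNNReal⟩
  · have hfinite : volume {u : ℝ | |u| ≤ R} ≠ ∞ := by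
      have : {u : ℝ | |u| ≤ R} = Set.Icc (-R) R := by
        ext u
        simp [abs_le]
      rw [this]
      exact measure_Icc_lt_top.ne
    refine Measure.integrableOn_of_bounded (M := ∫ ω, (τ ω).toReal ∂P) hfinite
      (((SkorokhodLevy.measurable_fourierHat hm₁).sub
        (SkorokhodLevy.measurable_fourierHat hm₀)).div T.measurable_exponent).aestronglyMeasurable
      (ae_restrict_of_ae ?_)
    -- off the null set of zeros of `η`, the quotient is the mean path integral
    filter_upwards [hne] with u hu
    rw [← hid u, mul_div_cancel_left₀ _ hu]
    exact SkorokhodLevy.norm_integral_expPathIntegral_le hτm hτ.finite_mean u
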